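/- Let $q$ be a power of a prime $p$, let $m>3$ and $n=q^m-1$, and put $$\delta=\begin{cases}(q^m-1)-2(q^{m/2}-1), & m\text{ even},\\ (q^m-1)-q^{(m-1)/2}, & m \text{ odd}.\end{cases}$$ Let $d<\delta$ be a nonnegative integer. A bicyclic code of length $n\times n$ over $\mathbb F_q$ is a linear subspace $C\subseteq\mathbb F_q^{n\times n}$ closed under cyclic shifts of the rows and of the columns. For primitive $n$-th roots of unity $\alpha,\beta\in\overline{\mathbb F_q}$, its defining set is the set of all $(x,y)\in\{0,\dots,n-1\}^2$ such that $\sum_{i,j}c_{ij}\alpha^{xi}\beta^{yj}=0$ for all $c\in C$. The (narrow-sense, primitive) hyperbolic code with designed distance $d$ is the bicyclic code with defining set $$Z=\{(xq^k \bmod n,\ yq^k \bmod n) : 1\le x,y\le n,\ xy<d,\ k\ge 0\}.$$ On $\mathbb C^{\mathbb F_q^{n\times n}}$ (the state space of $n^2$ qudits with $q$ levels, with orthonormal basis $|x\rangle$, $x\in\mathbb F_q^{n\times n}$) let $X(a)|x\rangle=|x+a\rangle$ and $Z(b)|x\rangle=e^{2\pi i\,\mathrm{tr}(b\cdot x)/p}|x\rangle$,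 where $\mathrm{tr}$ is the trace $\mathbb F_q\to\mathbb F_p$ and $b\cdot x=\sum_{i,j}b_{ij}x_{ij}$. The weight of $X(a)Z(b)$ is the number of positions at which $a$ or $b$ is nonzero. A stabilizer code is a nonzero subspace that is the joint $+1$ eigenspace of a group of operators of the form $e^{2\pi i c/p}X(a)Z(b)$, $c \in \mathbb Z/p$. A quantum code $Q$ has distance at least $d$ if for every $E=X(a)Z(b)$ of weight less than $d$ there is $c_E\in\mathbb C$ with $\langle\varphi|E|\psi\rangle=c_E\langle\varphi|\psi\rangle$ for all $\varphi,\psi\in Q$. Then there exists a quantum bicyclic code of length $n^2$, of dimension greater than $1$, and of distance at least $d$. More precisely, primitive $n$-th roots of unity exist in $\overline{\mathbb F_q}$, and for any two such roots $\alpha,\beta$ there is a narrow-sense hyperbolic code $C$ of length $n\times n$ over $\mathbb F_q$ with designed distance $d$ (with respect to $\alpha,\beta$) that contains its Euclidean dual $C^\perp$, and the CSS code of $C$, i.e. the joint $+1$ eigenspace of all $X(a)Z(b)$ with $a,b\in C^\perp$, is a stabilizer code on $n^2$ qudits of dimension greater than $1$ and of distance at least $d$. -/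

import Mathlib

/-! ### Bicyclic codes -/

section Bicyclic

variable {F K : Type*} [Field F] [Field K] [Algebra F K] {n₁ n₂ : ℕ}

/-- Circular right shift of the columns of an `n₁ × n₂` array. -/
def shiftColumns (c : Fin n₁ × Fin n₂ → F) : Fin n₁ × Fin n₂ → F :=
  fun z => c (z.1, (finRotate n₂).symm z.2)

/-- Circular down shift of the rows of an `n₁ × n₂` array. -/
def shiftRows (c : Fin n₁ × Fin n₂ → F) : Fin n₁ × Fin n₂ → F :=
  fun z => c ((finRotate n₁).symm z.1, z.2)

/-- A bicyclic code of length `n₁ × n₂`: a linear code of `n₁ × n₂` arrays, with `n₁ n₂` coprime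
to the size of the field, closed under both circular shifts. -/
structure IsBicyclicCode (C : Submodule F (Fin n₁ × Fin n₂ → F)) : Prop where
  coprime : Nat.Coprime (n₁ * n₂) (Nat.card F)
  shiftColumns_mem : ∀ c ∈ C, shiftColumns c ∈ C
  shiftRows_mem : ∀ c ∈ C, shiftRows c ∈ C

/-- The value `c(u, v) = ∑ c_{i,j} u^i v^j` of the code polynomial of `c` at a point `(u, v)` with
coordinates in an extension field. -/
def codePolyEval (c : Fin n₁ × Fin n₂ → F) (u v : K) : K :=
  ∑ i : Fin n₁, ∑ j : Fin n₂, algebraMap F K (c (i, j)) * u ^ (i : ℕ) * v ^ (j : ℕ)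

/-- The defining set of a code, with respect to `α` and `β`: all `(x, y)` with `0 ≤ x < n₁`,
`0 ≤ y < n₂` such that `(α ^ x, β ^ y)` is a common zero of the code polynomials. -/
def definingSet (α β : K) (C : Submodule F (Fin n₁ × Fin n₂ → F)) : Set (ℕ × ℕ) :=
  {z | z.1 < n₁ ∧ z.2 < n₂ ∧ ∀ c ∈ C, codePolyEval c (α ^ z.1) (β ^ z.2) = 0}

/-- The `q`-ary cyclotomic coset of `(x, y)` modulo `n₁` and `n₂`. -/
def cyclotomicCoset (q n₁ n₂ : ℕ) (z : ℕ × ℕ) : Set (ℕ × ℕ) :=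
  {w | ∃ k : ℕ, w = (z.1 * q ^ k % n₁, z.2 * q ^ k % n₂)}

/-- The designed set with offsets `a`, `b` and designed distance `d`. -/
def designedSet (n₁ n₂ a b d : ℕ) : Set (ℕ × ℕ) :=
  {w | ∃ x y : ℕ, 1 ≤ x ∧ x ≤ n₁ ∧ 1 ≤ y ∧ y ≤ n₂ ∧ x * y < d ∧
    w = ((a + x) % n₁, (b + y) % n₂)}

/-- `C` is a bicyclic hyperbolic code with offsets `a`, `b` and designed distance `d`, with respect
to the roots of unity `α` and `β`. -/
structure IsHyperbolicCode (α β : K) (a b d : ℕ) (C : Submodule F (Fin n₁ × Fin n₂ → F)) :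
    Prop where
  bicyclic : IsBicyclicCode C
  definingSet_eq : definingSet α β C =
    ⋃ z ∈ designedSet n₁ n₂ a b d, cyclotomicCoset (Nat.card F) n₁ n₂ z

/-- Narrow-sense hyperbolic codes: both offsets vanish. -/
abbrev IsNarrowSenseHyperbolicCode (α β : K) (d : ℕ)
    (C : Submodule F (Fin n₁ × Fin n₂ → F)) : Prop :=
  IsHyperbolicCode α β 0 0 d C

end Bicyclic

/-- The Euclidean dual code. -/
def euclideanDual {F ι : Type*} [Field F] [Fintype ι] (C : Submodule F (ι → F)) :
    Submodule F (ι → F) where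
  carrier := {u | ∀ v ∈ C, ∑ i, u i * v i = 0}
  zero_mem' := by simp
  add_mem' := by
    intro u u' hu hu' v hv
    simp [add_mul, Finset.sum_add_distrib, hu v hv, hu' v hv]
  smul_mem' := by
    intro r u hu v hv
    simp [mul_assoc, ← Finset.mul_sum, hu v hv]

/-- The bound `δ` on the design distance: `(q^m - 1) - 2 (q^(m/2) - 1)` for even `m` and
`(q^m - 1) - q^((m-1)/2)` for odd `m`. -/
def dualContainingBound (q m : ℕ) : ℤ :=
  if Even m then ((q : ℤ) ^ m - 1) - 2 * ((q : ℤ) ^ (m / 2) - 1)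
  else ((q : ℤ) ^ m - 1) - (q : ℤ) ^ ((m - 1) / 2)

/-! ### Quantum codes over qudits indexed by `ι`, with levels labelled by the finite field `F` -/

section Quantum

variable (p : ℕ) [Fact p.Prime] {F ι : Type*} [Field F] [Fintype F] [Algebra (ZMod p) F]
  [Fintype ι] [DecidableEq ι]

/-- The state space `(ℂ^F)^{⊗ ι}`, with orthonormal basis `|x⟩`, `x ∈ F^ι`. -/
abbrev QuditSpace (F ι : Type*) : Type _ := EuclideanSpace ℂ (ι → F)

/-- `X(a) |x⟩ = |x + a⟩`. -/
def errorX (a : ι → F) : QuditSpace F ι →ₗ[ℂ] QuditSpace F ι where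
  toFun ψ := WithLp.toLp 2 fun x => ψ (x - a)
  map_add' _ _ := by ext; simp
  map_smul' _ _ := by ext; simp

/-- `Z(b) |x⟩ = ω^{tr(b · x)} |x⟩` with `ω = exp(2πi/p)` and `tr` the trace from `F` to `𝔽_p`. -/
noncomputable def errorZ (b : ι → F) : QuditSpace F ι →ₗ[ℂ] QuditSpace F ι where
  toFun ψ := WithLp.toLp 2 fun x =>
    ZMod.stdAddChar (Algebra.trace (ZMod p) F (∑ i, b i * x i)) * ψ x
  map_add' _ _ := by ext; simp [mul_add]
  map_smul' _ _ := by ext; simp [mul_left_comm]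

/-- The error operator `X(a) Z(b)`. -/
noncomputable def errorOp (a b : ι → F) : QuditSpace F ι →ₗ[ℂ] QuditSpace F ι :=
  errorX a ∘ₗ errorZ p b

/-- The weight of `X(a) Z(b)`: the number of qudits on which it acts nontrivially. -/
noncomputable def errorWeight (a b : ι → F) : ℕ := {i | a i ≠ 0 ∨ b i ≠ 0}.ncard

/-- A stabilizer code: a nonzero subspace that is the joint eigenspace, for the eigenvalue `1`, of a
subgroup `S` of the error group `{ω^c X(a) Z(b)}`. -/
def IsStabilizerCode (Q : Submodule ℂ (QuditSpace F ι)) : Prop :=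
  Q ≠ ⊥ ∧ ∃ S : Subgroup (QuditSpace F ι ≃ₗ[ℂ] QuditSpace F ι),
    (∀ E ∈ S, ∃ (c : ZMod p) (a b : ι → F),
      (E : QuditSpace F ι →ₗ[ℂ] QuditSpace F ι) = (ZMod.stdAddChar c : ℂ) • errorOp p a b) ∧
    ∀ ψ, ψ ∈ Q ↔ ∀ E ∈ S, E ψ = ψ

/-- The quantum code `Q` has minimum distance at least `d`: every error operator of weight less
than `d` is detectable, in the sense of the Knill-Laflamme condition. -/
def HasDistanceAtLeast (Q : Submodule ℂ (QuditSpace F ι)) (d : ℕ) : Prop :=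
  ∀ a b : ι → F, errorWeight a b < d →
    ∃ c : ℂ, ∀ φ ∈ Q, ∀ ψ ∈ Q, inner ℂ φ (errorOp p a b ψ) = c * inner ℂ φ ψ

/-- The Calderbank-Shor-Steane code of a classical linear code `C` that contains its Euclidean
dual: the joint eigenspace, for the eigenvalue `1`, of all `X(a) Z(b)` with `a` and `b` in the dual
code. -/
noncomputable def cssCode (C : Submodule F (ι → F)) : Submodule ℂ (QuditSpace F ι) :=
  ⨅ a ∈ euclideanDual C, ⨅ b ∈ euclideanDual C, LinearMap.eqLocus (errorOp p a b) LinearMap.id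

end Quantum

/-!
Put `N = q ^ m`, `n = N - 1`, and let `Z` be the closure under multiplication by `q` of the set of
`(x, y)` with `x, y ≥ 1` and `x y < d`. The code `C` consists of all arrays `c` over `F` whose
spectrum `(x, y) ↦ c (α ^ x, β ^ y)` vanishes on `Z`.

*The defining set is exactly `Z`, and `C` contains its dual.* Both rest on the trace words, the
arrays with entries `Tr (α ^ l α ^ (u i) β ^ (v j))`, whose spectrum is supported on the negative
of the `q`-cyclotomic coset of `(u, v)`. A linear relation between the conjugates of `α ^ l` that
holds for all `l` is a `q`-linearized polynomial of degree below `n` with `n` zeros, hence trivial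
(`eq_zero_of_forall_sum_mul_pow_eq_zero`). Applied to the negative of a point outside `Z`, this
shows that the point is not a common zero of `C`. If `Z` and `-Z` are disjoint, the trace words of
a point of `Z` lie in `C`, and orthogonality to all of them forces the spectrum of a dual word to
vanish there (`euclideanDual_zeroCode_le`).

*`Z` and `-Z` are disjoint* (`false_of_dvd_of_mul_lt`). With `Q = q ^ k`, `R = q ^ (m - k)`, the
residues with `x Q + x' ≡ 0` modulo `Q R - 1` are `x = a R - t`, `x' = t Q - a` with `1 ≤ a ≤ Q`
and `1 ≤ t ≤ R`. Exchanging the two points allows `Q ≤ R`. If `x y` and `x' y'` were both small,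
then `x x'` or `y y'` would be small. But for `Q = R` always `x x' ≥ (Q - 1) ^ 2 = δ`, and for `Q <
R` the product `x x'` is below `N - 1 - Q` for only two values of `x`, which are excluded directly.
The case `k = 0` is elementary.

*The minimum distance of `C` is at least `d`* (`le_card_support_of_forall_mul_lt`). At the
lexicographically first point `(x, y)` with positive coordinates where the spectrum of `c ≠ 0` does
not vanish, a triangularity argument shows that `c` has weight at least `x y`.

*The quantum code* consists of the states supported on `C` and invariant under translation by the
dual code (`mem_cssCode_iff`). The coset states of `0` and of the all-one word, which lies in `C`
but not in its dual, are independent, so the dimension exceeds `1`. An error `X(a) Z(b)` of weight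
below `d` has `a = b = 0`, or `a ∉ C` and moves the support off `C`, or `a = 0`, `b ∉ C` and a
nontrivial character sum makes its matrix elements vanish.
-/

/-! ### Arithmetic of negated cyclotomic cosets -/

/-- The pairs `(x, x')` of residues modulo `Q R - 1` with `x Q + x' ≡ 0` are parametrized
symmetrically: `x = a R - t` and `x' = t Q - a`. -/
theorem exists_param_of_dvd {Q R x x' : ℤ} (hQ : 2 ≤ Q) (hx : 1 ≤ x)
    (hx' : 1 ≤ x') (hxn : x < Q * R - 1) (hxn' : x' < Q * R - 1)
    (h : Q * R - 1 ∣ x * Q + x') :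
    ∃ a t : ℤ, 1 ≤ a ∧ a ≤ Q ∧ 1 ≤ t ∧ t ≤ R ∧ x = a * R - t ∧ x' = t * Q - a := by
  obtain ⟨a, ha⟩ := h
  have hn : 0 < Q * R - 1 := by linarith
  have ha1 : 1 ≤ a := by
    have : 0 < (Q * R - 1) * a := by rw [← ha]; positivity
    exact (pos_iff_pos_of_mul_pos this).1 hn
  have ha2 : a ≤ Q := by
    by_contra! hlt
    have h1 : (Q * R - 1) * (Q + 1) ≤ (Q * R - 1) * a := by
      apply mul_le_mul_of_nonneg_left _ hn.le
      linarith
    nlinarith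
  have htQ : (a * R - x) * Q = x' + a := by linear_combination -ha
  refine ⟨a, a * R - x, ha1, ha2, ?_, ?_, by ring, by linarith⟩
  · by_contra! hlt
    nlinarith
  · by_contra! hlt
    nlinarith

/-- Away from the edges `a = 1` and `t = 1` the product of the two residues is large. -/
theorem mul_le_param_mul {Q R a t : ℤ} (hQ : 2 ≤ Q) (hR : 2 ≤ R) (ha : 2 ≤ a) (ht : 2 ≤ t)
    (haQ : a ≤ Q) (htR : t ≤ R) : Q * R ≤ (a * R - t) * (t * Q - a) := by
  have h1 : R ≤ a * R - t := by nlinarith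
  have h2 : Q ≤ t * Q - a := by nlinarith
  nlinarith [mul_le_mul h1 h2 (by linarith) (by linarith)]

theorem sub_one_mul_sub_one_le_param_mul {Q R a t : ℤ} (hQ : 2 ≤ Q) (hR : 2 ≤ R) (ha : 1 ≤ a)
    (ht : 1 ≤ t) (haQ : a ≤ Q) (htR : t ≤ R) (hx : 1 ≤ a * R - t) (hx' : 1 ≤ t * Q - a) :
    (Q - 1) * (R - 1) ≤ (a * R - t) * (t * Q - a) := by
  rcases ht.eq_or_lt with rfl | ht
  · nlinarith [mul_nonneg (sub_nonneg.2 ha)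
      (mul_nonneg (by linarith : 0 ≤ R) (by linarith : 0 ≤ Q - a - 1))]
  rcases ha.eq_or_lt with rfl | ha
  · nlinarith [mul_nonneg (sub_nonneg.2 ht.le)
      (mul_nonneg (by linarith : 0 ≤ Q) (by linarith : 0 ≤ R - t - 1))]
  · nlinarith [mul_le_param_mul hQ hR ha ht haQ htR]

/-- If `Q < R`, only two residues `x` have a product `x x'` below `Q R - 1 - Q`. By concavity in
each parameter it suffices to look at the end points of the edges `t = 1` and `a = 1`. -/
theorem param_eq_of_mul_lt {Q R a t : ℤ} (hQ : 2 ≤ Q) (hR : 2 * Q ≤ R) (ha : 1 ≤ a)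
    (ht : 1 ≤ t) (haQ : a ≤ Q) (htR : t ≤ R) (hx : 1 ≤ a * R - t) (hx' : 1 ≤ t * Q - a)
    (h : (a * R - t) * (t * Q - a) < Q * R - 1 - Q) : t = 1 ∧ (a = 1 ∨ a = Q - 1) := by
  rcases ht.eq_or_lt with rfl | ht
  · refine ⟨rfl, ?_⟩
    by_contra! hne
    obtain ⟨h1, h2⟩ := hne
    have h3 : 2 ≤ a := by omega
    have h4 : a ≤ Q - 2 := by omega
    nlinarith [mul_nonneg (by linarith : 0 ≤ R)
      (mul_nonneg (sub_nonneg.2 h3) (sub_nonneg.2 h4)),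
      mul_nonneg (by linarith : 0 ≤ R) (by linarith : 0 ≤ Q - 4)]
  exfalso
  rcases ha.eq_or_lt with rfl | ha
  · have h3 : 2 ≤ t := ht
    have h4 : t ≤ R - 1 := by linarith
    nlinarith [mul_nonneg (by linarith : 0 ≤ Q)
      (mul_nonneg (sub_nonneg.2 h3) (sub_nonneg.2 h4)),
      mul_nonneg (by linarith : 0 ≤ Q - 1) (sub_nonneg.2 h4)]
  · nlinarith [mul_le_param_mul hQ (by linarith) ha ht haQ htR]

/-- For `Q = R`, the case of the middle exponent of an even `m`. -/
theorem false_of_mul_lt_of_eq {Q x y x' y' : ℤ} (hQ : 2 ≤ Q) (hx : 1 ≤ x) (hy : 1 ≤ y)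
    (hx' : 1 ≤ x') (hy' : 1 ≤ y') (hxn : x < Q * Q - 1) (hyn : y < Q * Q - 1)
    (hxn' : x' < Q * Q - 1) (hyn' : y' < Q * Q - 1)
    (hxx : Q * Q - 1 ∣ x * Q + x') (hyy : Q * Q - 1 ∣ y * Q + y')
    (h : x * y < (Q - 1) * (Q - 1)) (h' : x' * y' < (Q - 1) * (Q - 1)) : False := by
  obtain ⟨a, t, ha, haQ, ht, htR, rfl, rfl⟩ := exists_param_of_dvd hQ hx hx' hxn hxn' hxx
  obtain ⟨b, s, hb, hbQ, hs, hsR, rfl, rfl⟩ := exists_param_of_dvd hQ hy hy' hyn hyn' hyy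
  have h1 := sub_one_mul_sub_one_le_param_mul hQ hQ ha ht haQ htR hx hx'
  have h2 := sub_one_mul_sub_one_le_param_mul hQ hQ hb hs hbQ hsR hy hy'
  have h3 := mul_lt_mul'' h h' (by positivity) (by positivity)
  have h4 := mul_le_mul h1 h2 (by nlinarith) (by positivity)
  linarith [mul_mul_mul_comm (a * Q - t) (t * Q - a) (b * Q - s) (s * Q - b)]

/-- The two exceptional residues with a small product `x x'` confine `y`, and then one
of the products `x y`, `x' y'` is too large. -/
theorem false_of_mul_lt_of_lt_aux {Q R x y x' y' : ℤ} (hQ : 2 ≤ Q) (hR : 2 * Q ≤ R) (hx : 1 ≤ x)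
    (hy : 1 ≤ y) (hx' : 1 ≤ x') (hy' : 1 ≤ y') (hxn : x < Q * R - 1) (hyn : y < Q * R - 1)
    (hxn' : x' < Q * R - 1) (hyn' : y' < Q * R - 1)
    (hxx : Q * R - 1 ∣ x * Q + x') (hyy : Q * R - 1 ∣ y * Q + y')
    (h : x * y < Q * R - 1 - Q) (h' : x' * y' < Q * R - 1 - Q)
    (hlt : x * x' < Q * R - 1 - Q) : False := by
  obtain ⟨a, t, ha, haQ, ht, htR, rfl, rfl⟩ := exists_param_of_dvd hQ hx hx' hxn hxn' hxx
  obtain ⟨b, s, hb, hbQ, hs, hsR, rfl, rfl⟩ := exists_param_of_dvd hQ hy hy' hyn hyn' hyy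
  obtain ⟨rfl, rfl | rfl⟩ := param_eq_of_mul_lt hQ hR ha ht haQ htR hx hx' hlt
  · -- Here `x = R - 1`, `x' = Q - 1`, which forces `y < Q`, hence `b = 1` and `y'` is large.
    have h1 : b * R - s < Q := by
      by_contra! hge
      nlinarith [mul_le_mul_of_nonneg_left hge (by linarith : 0 ≤ R - 1)]
    have h2 : b = 1 := by nlinarith
    subst h2
    have h3 : R - Q + 1 ≤ s := by linarith
    rcases hQ.eq_or_lt with rfl | hQ
    · linarith
    · have h4 : (R - Q + 1) * Q - 1 ≤ s * Q - 1 := by nlinarith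
      have h5 := mul_le_mul_of_nonneg_left h4 (by linarith : 0 ≤ Q - 1)
      have h6 : 0 ≤ (Q - 2) * (R - 2 * Q) := mul_nonneg (by linarith) (by linarith)
      have h7 : 0 ≤ Q * Q - 2 * Q - 1 := by nlinarith
      have h8 : 0 ≤ (Q - 1) * (R - Q + 1) - R := by nlinarith
      nlinarith [mul_nonneg (by linarith : 0 ≤ Q) h8]
  · -- Here `x' = 1` and `x` exceeds half the bound, which forces `y = 1`.
    have h1 : b * R - s < 2 := by
      by_contra! hge
      nlinarith [mul_le_mul_of_nonneg_left hge (by linarith : 0 ≤ (Q - 1) * R - 1)]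
    have h2 : b = 1 := by nlinarith
    subst h2
    have h3 : s = R - 1 := by linarith
    subst h3
    nlinarith

/-- For `2 Q ≤ R`, the case of every other exponent. -/
theorem false_of_mul_lt_of_lt {Q R x y x' y' : ℤ} (hQ : 2 ≤ Q) (hR : 2 * Q ≤ R) (hx : 1 ≤ x)
    (hy : 1 ≤ y) (hx' : 1 ≤ x') (hy' : 1 ≤ y') (hxn : x < Q * R - 1) (hyn : y < Q * R - 1)
    (hxn' : x' < Q * R - 1) (hyn' : y' < Q * R - 1)
    (hxx : Q * R - 1 ∣ x * Q + x') (hyy : Q * R - 1 ∣ y * Q + y')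
    (h : x * y < Q * R - 1 - Q) (h' : x' * y' < Q * R - 1 - Q) : False := by
  rcases lt_or_ge (x * x') (Q * R - 1 - Q) with h1 | h1
  · exact false_of_mul_lt_of_lt_aux hQ hR hx hy hx' hy' hxn hyn hxn' hyn' hxx hyy h h' h1
  rcases lt_or_ge (y * y') (Q * R - 1 - Q) with h2 | h2
  · exact false_of_mul_lt_of_lt_aux hQ hR hy hx hy' hx' hyn hxn hyn' hxn' hyy hxx
      (by rwa [mul_comm]) (by rwa [mul_comm]) h2
  have h3 := mul_lt_mul'' h h' (by positivity) (by positivity)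
  have h4 := mul_le_mul h1 h2 (by nlinarith) (by positivity)
  linarith [mul_mul_mul_comm x x' y y']

theorem dualContainingBound_le_of_le {q m k : ℕ} (hq : 2 ≤ q) (hm : 3 < m) (hk : 2 * k < m) :
    dualContainingBound q m ≤ (q : ℤ) ^ m - 1 - (q : ℤ) ^ k := by
  have hq1 : (1 : ℤ) ≤ q := by exact_mod_cast (by omega : 1 ≤ q)
  unfold dualContainingBound
  split_ifs with h
  · obtain ⟨r, rfl⟩ := h
    have e : (r + r) / 2 = (r - 1) + 1 := by omega
    have h1 : (q : ℤ) ^ k ≤ (q : ℤ) ^ (r - 1) := pow_le_pow_right₀ hq1 (by omega)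
    have h2 : (q : ℤ) ^ 1 ≤ (q : ℤ) ^ (r - 1) := pow_le_pow_right₀ hq1 (by omega)
    have hq2 : (2 : ℤ) ≤ q := by exact_mod_cast hq
    rw [e, pow_succ (q : ℤ) (r - 1)]
    nlinarith
  · have h1 : (q : ℤ) ^ k ≤ (q : ℤ) ^ ((m - 1) / 2) := pow_le_pow_right₀ hq1 (by omega)
    linarith

theorem dualContainingBound_le {q m : ℕ} (hq : 2 ≤ q) (hm : 3 < m) :
    dualContainingBound q m ≤ (q : ℤ) ^ m - 2 := by
  have := dualContainingBound_le_of_le (k := 0) hq hm (by omega)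
  rw [pow_zero] at this
  linarith

/-- The case of an exponent `1 ≤ k ≤ m / 2`; the other exponents reduce to it by exchanging the two
points. -/
theorem false_of_dvd_of_two_mul_le {q m k : ℕ} {D x y x' y' : ℤ} (hq : 2 ≤ q) (hm : 3 < m)
    (hk : 1 ≤ k) (hkm : 2 * k ≤ m) (hD : D ≤ dualContainingBound q m)
    (hx : 1 ≤ x) (hy : 1 ≤ y) (hx' : 1 ≤ x') (hy' : 1 ≤ y') (h : x * y < D) (h' : x' * y' < D)
    (hxx : (q : ℤ) ^ m - 1 ∣ x * q ^ k + x') (hyy : (q : ℤ) ^ m - 1 ∣ y * q ^ k + y') :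
    False := by
  have hq2 : (2 : ℤ) ≤ q := by exact_mod_cast hq
  have hQ : (2 : ℤ) ≤ (q : ℤ) ^ k := by
    calc (2 : ℤ) ≤ (q : ℤ) ^ 1 := by simpa using hq2
      _ ≤ _ := pow_le_pow_right₀ (by linarith) hk
  have e : (q : ℤ) ^ m = q ^ k * q ^ (m - k) := by rw [← pow_add]; congr 1; omega
  have hb := dualContainingBound_le hq hm
  have b1 : x < (q : ℤ) ^ m - 1 := by nlinarith
  have b2 : y < (q : ℤ) ^ m - 1 := by nlinarith
  have b3 : x' < (q : ℤ) ^ m - 1 := by nlinarith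
  have b4 : y' < (q : ℤ) ^ m - 1 := by nlinarith
  rcases hkm.eq_or_lt with rfl | hlt
  · have hbd : dualContainingBound q (2 * k) = ((q : ℤ) ^ k - 1) * (q ^ k - 1) := by
      have e2 : 2 * k / 2 = k := by omega
      rw [dualContainingBound, if_pos (even_two_mul k), e2, two_mul, pow_add]
      ring
    rw [two_mul, pow_add] at b1 b2 b3 b4 hxx hyy
    exact false_of_mul_lt_of_eq hQ hx hy hx' hy' b1 b2 b3 b4 hxx hyy (by linarith) (by linarith)
  · have hR : 2 * (q : ℤ) ^ k ≤ q ^ (m - k) := by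
      calc 2 * (q : ℤ) ^ k ≤ q ^ (k + 1) := by rw [pow_succ]; nlinarith
        _ ≤ _ := pow_le_pow_right₀ (by linarith) (by omega)
    have := dualContainingBound_le_of_le hq hm hlt
    rw [e] at this b1 b2 b3 b4 hxx hyy
    exact false_of_mul_lt_of_lt hQ hR hx hy hx' hy' b1 b2 b3 b4 hxx hyy (by linarith) (by linarith)

/-- The arithmetic core of dual containment: below the bound `δ`, no point of the designed set is
congruent to a multiple by `-q ^ k` of another one. -/
theorem false_of_dvd_of_mul_lt {q m : ℕ} {D x y x' y' : ℤ} (hq : 2 ≤ q) (hm : 3 < m)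
    (hD : D ≤ dualContainingBound q m)
    (hx : 1 ≤ x) (hy : 1 ≤ y) (hx' : 1 ≤ x') (hy' : 1 ≤ y') (h : x * y < D) (h' : x' * y' < D)
    (k : ℕ)
    (hxx : (q : ℤ) ^ m - 1 ∣ x * q ^ k + x') (hyy : (q : ℤ) ^ m - 1 ∣ y * q ^ k + y') :
    False := by
  set n := (q : ℤ) ^ m - 1 with hn
  have hqm : (q : ℤ) ^ m ≡ 1 [ZMOD n] := (Int.modEq_iff_dvd.2 ⟨1, by ring⟩).symm
  have hmod : (q : ℤ) ^ k ≡ q ^ (k % m) [ZMOD n] := by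
    conv_lhs => rw [← Nat.div_add_mod k m, pow_add, pow_mul]
    simpa using (hqm.pow (k / m)).mul_right (q ^ (k % m))
  have hred : ∀ {z z' : ℤ}, n ∣ z * q ^ k + z' → n ∣ z * q ^ (k % m) + z' := fun {z z'} hz =>
    ((hmod.mul_left z).add_right z').dvd_iff.1 hz
  replace hxx := hred hxx
  replace hyy := hred hyy
  have hr : k % m < m := Nat.mod_lt _ (by omega)
  generalize k % m = r at hxx hyy hr
  rcases Nat.eq_zero_or_pos r with rfl | hr0
  · -- `x + x'` and `y + y'` are at least `n`, so one of the products is at least `n - 1`.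
    rw [pow_zero, mul_one] at hxx hyy
    have h1 := Int.le_of_dvd (by linarith) hxx
    have h2 := Int.le_of_dvd (by linarith) hyy
    have hb := dualContainingBound_le hq hm
    rcases le_total n (x + y) with h3 | h3
    · nlinarith [mul_nonneg (sub_nonneg.2 hx) (sub_nonneg.2 hy)]
    · nlinarith [mul_nonneg (sub_nonneg.2 hx') (sub_nonneg.2 hy')]
  rcases le_or_gt (2 * r) m with h2 | h2
  · exact false_of_dvd_of_two_mul_le hq hm hr0 h2 hD hx hy hx' hy' h h' hxx hyy
  · have hswap : ∀ {z z' : ℤ}, n ∣ z * q ^ r + z' → n ∣ z' * q ^ (m - r) + z := by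
      intro z z' hz
      have e : (q : ℤ) ^ m = q ^ r * q ^ (m - r) := by rw [← pow_add]; congr 1; omega
      have h3 : z' * q ^ (m - r) + z = (z * q ^ r + z') * q ^ (m - r) - n * z := by
        rw [hn, e]; ring
      rw [h3]
      exact dvd_sub (hz.mul_right _) (dvd_mul_right _ _)
    exact false_of_dvd_of_two_mul_le hq hm (by omega) (by omega) hD hx' hy' hx hy h' h
      (hswap hxx) (hswap hyy)

/-! ### Spectra of arrays over a finite field -/

section Spectrum

variable {F K : Type*} [Field F] [Field K] [Algebra F K] {n : ℕ}

theorem codePolyEval_eq_sum {n₁ n₂ : ℕ} (c : Fin n₁ × Fin n₂ → F) (u v : K) :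
    codePolyEval c u v = ∑ z, algebraMap F K (c z) * u ^ (z.1 : ℕ) * v ^ (z.2 : ℕ) := by
  rw [codePolyEval, Fintype.sum_prod_type]

theorem codePolyEval_add {n₁ n₂ : ℕ} (c c' : Fin n₁ × Fin n₂ → F) (u v : K) :
    codePolyEval (c + c') u v = codePolyEval c u v + codePolyEval c' u v := by
  simp [codePolyEval_eq_sum, add_mul, Finset.sum_add_distrib]

theorem codePolyEval_smul {n₁ n₂ : ℕ} (r : F) (c : Fin n₁ × Fin n₂ → F) (u v : K) :
    codePolyEval (r • c) u v = algebraMap F K r * codePolyEval c u v := by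
  simp [codePolyEval_eq_sum, mul_assoc, Finset.mul_sum]

/-- The code of all arrays whose code polynomials vanish at `(α ^ x, β ^ y)` for `(x, y) ∈ Z`. -/
def zeroCode (F : Type*) [Field F] [Algebra F K] (n₁ n₂ : ℕ) (α β : K) (Z : Set (ℕ × ℕ)) :
    Submodule F (Fin n₁ × Fin n₂ → F) where
  carrier := {c | ∀ z ∈ Z, codePolyEval c (α ^ z.1) (β ^ z.2) = 0}
  zero_mem' := by simp [codePolyEval]
  add_mem' := by
    intro c c' hc hc' z hz
    rw [codePolyEval_add, hc z hz, hc' z hz, add_zero]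
  smul_mem' := by
    intro r c hc z hz
    rw [codePolyEval_smul, hc z hz, mul_zero]

theorem pow_finRotate {u : K} (hu : u ^ n = 1) (i : Fin n) :
    u ^ (finRotate n i : ℕ) = u * u ^ (i : ℕ) := by
  cases n with
  | zero => exact i.elim0
  | succ k =>
    rw [coe_finRotate]
    split_ifs with h
    · rw [h, Fin.val_last, ← pow_succ', hu, pow_zero]
    · rw [pow_succ']

theorem codePolyEval_shiftRows {n₁ n₂ : ℕ} (c : Fin n₁ × Fin n₂ → F) {u : K} (v : K)
    (hu : u ^ n₁ = 1) : codePolyEval (shiftRows c) u v = u * codePolyEval c u v := by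
  unfold codePolyEval
  rw [← Equiv.sum_comp (finRotate n₁), Finset.mul_sum]
  refine Finset.sum_congr rfl fun i _ => ?_
  rw [Finset.mul_sum]
  refine Finset.sum_congr rfl fun j _ => ?_
  simp only [shiftRows, Equiv.symm_apply_apply, pow_finRotate hu]
  ring

theorem codePolyEval_shiftColumns {n₁ n₂ : ℕ} (c : Fin n₁ × Fin n₂ → F) (u : K) {v : K}
    (hv : v ^ n₂ = 1) : codePolyEval (shiftColumns c) u v = v * codePolyEval c u v := by
  unfold codePolyEval
  rw [Finset.mul_sum]
  refine Finset.sum_congr rfl fun i _ => ?_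
  rw [← Equiv.sum_comp (finRotate n₂), Finset.mul_sum]
  refine Finset.sum_congr rfl fun j _ => ?_
  simp only [shiftColumns, Equiv.symm_apply_apply, pow_finRotate hv]
  ring

theorem isBicyclicCode_zeroCode {n₁ n₂ : ℕ} {α β : K} (hα : α ^ n₁ = 1) (hβ : β ^ n₂ = 1)
    (hcop : Nat.Coprime (n₁ * n₂) (Nat.card F)) (Z : Set (ℕ × ℕ)) :
    IsBicyclicCode (zeroCode F n₁ n₂ α β Z) where
  coprime := hcop
  shiftColumns_mem c hc z hz := by
    rw [codePolyEval_shiftColumns c _ (by rw [← pow_mul', pow_mul, hβ, one_pow]), hc z hz, mul_zero]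
  shiftRows_mem c hc z hz := by
    rw [codePolyEval_shiftRows c _ (by rw [← pow_mul', pow_mul, hα, one_pow]), hc z hz, mul_zero]

/-- A nonzero array has a nonzero spectral coefficient: the Fourier transform is injective. -/
theorem exists_codePolyEval_ne_zero {α β : K} (hα : IsPrimitiveRoot α n)
    (hβ : IsPrimitiveRoot β n) {c : Fin n × Fin n → F} (hc : c ≠ 0) :
    ∃ x y : ℕ, 1 ≤ x ∧ 1 ≤ y ∧ codePolyEval c (α ^ x) (β ^ y) ≠ 0 := by
  by_contra! h
  have hinj : ∀ {γ : K}, IsPrimitiveRoot γ n →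
      Function.Injective fun i : Fin n => γ ^ ((i : ℕ) + 1) := by
    intro γ hγ i j hij
    have hn : n ≠ 0 := by have := i.2; omega
    have h0 : γ ≠ 0 := hγ.ne_zero hn
    simp only [pow_succ] at hij
    exact Fin.ext (hγ.pow_inj i.2 j.2 (mul_right_cancel₀ h0 hij))
  apply hc
  funext ⟨i, j⟩
  have h1 : ∀ y : Fin n, ∀ i : Fin n,
      ∑ j, algebraMap F K (c (i, j)) * (β ^ ((y : ℕ) + 1)) ^ (j : ℕ) = 0 := by
    intro y
    have := Matrix.eq_zero_of_forall_index_sum_pow_mul_eq_zero (hinj hα)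
      (v := fun i => ∑ j, algebraMap F K (c (i, j)) * (β ^ ((y : ℕ) + 1)) ^ (j : ℕ)) ?_
    · exact fun i => congrFun this i
    · intro x
      rw [← h (x + 1) (y + 1) (by omega) (by omega), codePolyEval]
      refine Finset.sum_congr rfl fun i _ => ?_
      rw [Finset.mul_sum]
      exact Finset.sum_congr rfl fun j _ => by ring
  have h2 := Matrix.eq_zero_of_forall_index_sum_pow_mul_eq_zero (hinj hβ)
      (v := fun j => algebraMap F K (c (i, j))) fun y => by
    rw [← h1 y i]
    exact Finset.sum_congr rfl fun j _ => mul_comm _ _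
  simpa using congrFun h2 j

/-! ### The hyperbolic bound -/

/-- If `(x, y)` is the lexicographically first point with positive coordinates at which the
spectrum of `c` does not vanish, then `c` has weight at least `x y`. Otherwise some nonzero
polynomial with monomials in a box of size `x × y` vanishes on the support of `c`; comparing it
with the shifted spectrum at its lexicographically last monomial gives a contradiction. -/
theorem mul_le_card_support {n₁ n₂ : ℕ} (α β : K) (c : Fin n₁ × Fin n₂ → F) {x y : ℕ}
    (hne : codePolyEval c (α ^ x) (β ^ y) ≠ 0)
    (hzero : ∀ a b, 1 ≤ a → 1 ≤ b → (a < x ∨ a = x ∧ b < y) →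
      codePolyEval c (α ^ a) (β ^ b) = 0) :
    x * y ≤ {z | c z ≠ 0}.ncard := by
  classical
  by_contra! hlt
  -- The kernel of `L` consists of the polynomials with degrees below `(x, y)` that vanish on the
  -- support of `c`; it is nontrivial because there are more monomials than support points.
  let L : (Fin x × Fin y → K) →ₗ[K] ({z // c z ≠ 0} → K) :=
    { toFun := fun h z => ∑ w, h w * (α ^ (z.1.1 : ℕ)) ^ (w.1 : ℕ) * (β ^ (z.1.2 : ℕ)) ^ (w.2 : ℕ)
      map_add' := by intro g h; ext z; simp [add_mul, Finset.sum_add_distrib]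
      map_smul' := by intro r g; ext z; simp [mul_assoc, Finset.mul_sum] }
  have hker : LinearMap.ker L ≠ ⊥ := by
    apply LinearMap.ker_ne_bot_of_finrank_lt
    simp only [Module.finrank_fintype_fun_eq_card, Fintype.card_prod, Fintype.card_fin]
    rwa [← Nat.card_eq_fintype_card, ← Set.coe_ofPred, Nat.card_coe_set_eq]
  obtain ⟨h, hh, h0⟩ := Submodule.exists_mem_ne_zero_of_ne_bot hker
  have hL : ∀ z, c z ≠ 0 →
      ∑ w, h w * (α ^ (z.1 : ℕ)) ^ (w.1 : ℕ) * (β ^ (z.2 : ℕ)) ^ (w.2 : ℕ) = 0 := fun z hz =>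
    congrFun (LinearMap.mem_ker.1 hh) ⟨z, hz⟩
  obtain ⟨w₀, hw₀⟩ := Function.ne_iff.1 h0
  obtain ⟨w', hw', hmax⟩ := Finset.exists_max_image (Finset.univ.filter fun w => h w ≠ 0) toLex
    ⟨w₀, by simpa using hw₀⟩
  have hw'0 : h w' ≠ 0 := (Finset.mem_filter.1 hw').2
  -- The sum over the support of `c` times a monomial times the polynomial `h`. In the order chosen,
  -- only the last monomial `w'` of `h` contributes.
  have key : ∑ w, h w * codePolyEval c (α ^ (x - w'.1 + w.1)) (β ^ (y - w'.2 + w.2)) = 0 := by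
    simp only [codePolyEval_eq_sum, Finset.mul_sum]
    rw [Finset.sum_comm]
    refine Finset.sum_eq_zero fun z _ => ?_
    by_cases hz : c z = 0
    · simp [hz]
    · rw [← mul_zero (algebraMap F K (c z) * (α ^ (x - w'.1)) ^ (z.1 : ℕ) *
        (β ^ (y - w'.2)) ^ (z.2 : ℕ)), ← hL z hz, Finset.mul_sum]
      refine Finset.sum_congr rfl fun w _ => ?_
      rw [pow_add, pow_add, mul_pow, mul_pow, pow_right_comm α z.1, pow_right_comm β z.2]
      ring
  have hx := w'.1.2
  have hy := w'.2.2
  rw [Finset.sum_eq_single w'] at key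
  · rw [Nat.sub_add_cancel hx.le, Nat.sub_add_cancel hy.le] at key
    exact (mul_ne_zero hw'0 hne) key
  · intro w _ hww
    by_cases hw : h w = 0
    · rw [hw, zero_mul]
    · have hle := hmax w (by simpa using hw)
      rw [Prod.Lex.toLex_le_toLex] at hle
      rw [hzero _ _ (by omega) (by omega), mul_zero]
      rcases hle with h1 | ⟨h1, h2⟩
      · have : (w.1 : ℕ) < w'.1 := h1
        omega
      · have h3 : (w.2 : ℕ) < w'.2 := by
          refine lt_of_le_of_ne h2 fun h4 => hww (Prod.ext h1 (Fin.ext h4))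
        rw [h1]
        omega
  · simp

/-- The hyperbolic bound: an array whose spectrum vanishes at all `(x, y)` with `x, y ≥ 1` and
`x y < d` is zero or has weight at least `d`. -/
theorem le_card_support_of_forall_mul_lt {α β : K} (hα : IsPrimitiveRoot α n)
    (hβ : IsPrimitiveRoot β n) {c : Fin n × Fin n → F} (hc : c ≠ 0) {d : ℕ}
    (hd : ∀ x y, 1 ≤ x → 1 ≤ y → x * y < d → codePolyEval c (α ^ x) (β ^ y) = 0) :
    d ≤ {z | c z ≠ 0}.ncard := by
  classical
  have hex : ∃ x, 1 ≤ x ∧ ∃ y, 1 ≤ y ∧ codePolyEval c (α ^ x) (β ^ y) ≠ 0 := by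
    obtain ⟨x, y, hx, hy, h⟩ := exists_codePolyEval_ne_zero hα hβ hc
    exact ⟨x, hx, y, hy, h⟩
  obtain ⟨hx, hey⟩ := Nat.find_spec hex
  have hxmin := fun a => Nat.find_min hex (m := a)
  generalize Nat.find hex = x at hx hey hxmin
  obtain ⟨hy, hne⟩ := Nat.find_spec hey
  have hymin := fun b => Nat.find_min hey (m := b)
  generalize Nat.find hey = y at hy hne hymin
  refine le_trans ?_ (mul_le_card_support α β c hne ?_)
  · by_contra! hlt
    exact hne (hd x y hx hy hlt)
  · rintro a b ha hb (h | ⟨rfl, h⟩)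
    · by_contra h0
      exact hxmin a h ⟨ha, b, hb, h0⟩
    · by_contra h0
      exact hymin b h ⟨hb, h0⟩

end Spectrum

/-! ### Trace codewords -/

section Trace

variable {F K : Type*} [Field F] [Field K] [Algebra F K] {q m n : ℕ}

theorem exists_algebraMap_eq_of_pow_card_eq [Fintype F] {z : K} (hz : z ^ Fintype.card F = z) :
    ∃ a : F, algebraMap F K a = z := by
  classical
  have hroot : z ∈ ((Polynomial.X ^ Fintype.card F - Polynomial.X : Polynomial F).map
      (algebraMap F K)).roots := by
    rw [Polynomial.mem_roots (by
      simpa using FiniteField.X_pow_card_sub_X_ne_zero K Fintype.one_lt_card)]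
    simp [hz]
  rw [← Polynomial.roots_map_of_injective_of_card_eq_natDegree
    (algebraMap F K).injective, FiniteField.roots_X_pow_card_sub_X] at hroot
  · simpa using hroot
  · rw [FiniteField.roots_X_pow_card_sub_X,
      FiniteField.X_pow_card_sub_X_natDegree_eq F Fintype.one_lt_card]
    rfl

theorem sum_pow_card_pow [Fintype F] {ι : Type*} (s : Finset ι) (f : ι → K) (k : ℕ) :
    (∑ i ∈ s, f i) ^ Fintype.card F ^ k = ∑ i ∈ s, f i ^ Fintype.card F ^ k := by
  induction k with
  | zero => simp
  | succ k ih =>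
    simp only [pow_succ, pow_mul]
    rw [ih]
    exact map_sum (FiniteField.frobeniusAlgHom F K) _ _

/-- The trace of an element of the field with `q ^ m` elements lies in the field with `q`
elements. -/
theorem exists_algebraMap_eq_sum_pow [Fintype F] (hq : Fintype.card F = q) {w : K}
    (hw : w ^ q ^ m = w) :
    ∃ a : F, algebraMap F K a = ∑ k ∈ Finset.range m, w ^ q ^ k := by
  subst hq
  apply exists_algebraMap_eq_of_pow_card_eq
  have h := sum_pow_card_pow (F := F) (Finset.range m) (fun k => w ^ Fintype.card F ^ k) 1
  rw [pow_one] at h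
  rw [h]
  simp only [← pow_mul, ← pow_succ]
  have h2 := Finset.sum_range_succ' (fun k => w ^ Fintype.card F ^ k) m
  rw [Finset.sum_range_succ, hw, pow_zero, pow_one] at h2
  exact (add_right_cancel h2).symm

/-- A `q`-linearized polynomial of degree less than `q ^ m - 1` that vanishes at all powers of a
primitive root of unity of order `q ^ m - 1` is zero. -/
theorem eq_zero_of_forall_sum_mul_pow_eq_zero {α : K} (hα : IsPrimitiveRoot α n) (hq : 2 ≤ q)
    (hm : 1 < m) (hn : n = q ^ m - 1) {e : ℕ → K}
    (h : ∀ l, ∑ k ∈ Finset.range m, e k * (α ^ l) ^ q ^ k = 0) {k : ℕ} (hk : k < m) :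
    e k = 0 := by
  have hp := Polynomial.eq_zero_of_natDegree_lt_card_of_eval_eq_zero
    (∑ k ∈ Finset.range m, Polynomial.C (e k) * Polynomial.X ^ q ^ k)
    (f := fun l : Fin n => α ^ (l : ℕ))
    (fun i j hij => Fin.ext (hα.pow_inj i.2 j.2 hij))
    (fun l => by simpa [Polynomial.eval_finsetSum] using h l) ?_
  · have h1 := congrArg (fun p => Polynomial.coeff p (q ^ k)) hp
    simp only [Polynomial.finsetSum_coeff, Polynomial.coeff_C_mul_X_pow,
      Polynomial.coeff_zero] at h1
    rw [Finset.sum_eq_single k] at h1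
    · simpa using h1
    · intro b _ hb
      rw [if_neg fun h2 => hb (Nat.pow_right_injective hq h2).symm]
    · intro h2
      exact absurd (Finset.mem_range.2 hk) h2
  · have h2 : q ^ (m - 1) < n := by
      have h3 : q ^ m = q ^ (m - 1) * q := by rw [← pow_succ]; congr 1; omega
      have h4 : 1 < q ^ (m - 1) := Nat.one_lt_pow (by omega) (by omega)
      have h5 : q ^ (m - 1) * 2 ≤ q ^ (m - 1) * q := Nat.mul_le_mul_left _ hq
      omega
    rw [Fintype.card_fin]
    refine lt_of_le_of_lt (Polynomial.natDegree_sum_le_of_forall_le _ _ fun k hk => ?_) h2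
    refine (Polynomial.natDegree_C_mul_X_pow_le _ _).trans (Nat.pow_le_pow_right (by omega) ?_)
    have := Finset.mem_range.1 hk
    omega

theorem pow_card_eq_self {γ : K} (hγ : γ ^ n = 1) (hq : 2 ≤ q) (hn : n = q ^ m - 1) :
    γ ^ q ^ m = γ := by
  have : q ^ m = n + 1 := by
    have : 0 < q ^ m := by positivity
    omega
  rw [this, pow_succ, hγ, one_mul]

/-- The array with entries `Tr (α ^ l α ^ (u i) β ^ (v j))`, where `Tr` is the trace from the field
with `q ^ m` elements. Its spectrum is supported on the negative of the coset of `(u, v)`. -/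
theorem exists_traceWord [Fintype F] {α β : K} (hα : α ^ n = 1) (hβ : β ^ n = 1)
    (hq : Fintype.card F = q) (hn : n = q ^ m - 1) (l u v : ℕ) :
    ∃ c : Fin n × Fin n → F, ∀ z, algebraMap F K (c z) =
      ∑ k ∈ Finset.range m, (α ^ l * (α ^ u) ^ (z.1 : ℕ) * (β ^ v) ^ (z.2 : ℕ)) ^ q ^ k := by
  have hq2 : 2 ≤ q := hq ▸ Fintype.one_lt_card
  have : ∀ z : Fin n × Fin n, ∃ a : F, algebraMap F K a =
      ∑ k ∈ Finset.range m, (α ^ l * (α ^ u) ^ (z.1 : ℕ) * (β ^ v) ^ (z.2 : ℕ)) ^ q ^ k := by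
    intro z
    apply exists_algebraMap_eq_sum_pow hq
    apply pow_card_eq_self _ hq2 hn
    simp only [mul_pow, ← pow_mul, mul_comm _ n]
    simp [pow_mul, hα, hβ]
  choose c hc using this
  exact ⟨c, hc⟩

theorem sum_pow_eq_ite {α : K} (hα : IsPrimitiveRoot α n) (a : ℕ) :
    ∑ i : Fin n, (α ^ a) ^ (i : ℕ) = if n ∣ a then (n : K) else 0 := by
  rw [Fin.sum_univ_eq_sum_range fun i => (α ^ a) ^ i]
  split_ifs with h
  · simp [(hα.pow_eq_one_iff_dvd a).2 h]
  · have h1 : α ^ a ≠ 1 := fun h1 => h ((hα.pow_eq_one_iff_dvd a).1 h1)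
    have h2 := geom_sum_mul (α ^ a) n
    rw [pow_right_comm, hα.pow_eq_one, one_pow, sub_self] at h2
    exact (mul_eq_zero.1 h2).resolve_right (sub_ne_zero.2 h1)

theorem codePolyEval_traceWord {α β : K} (hα : IsPrimitiveRoot α n) (hβ : IsPrimitiveRoot β n)
    {l u v : ℕ} {c : Fin n × Fin n → F}
    (hc : ∀ z, algebraMap F K (c z) =
      ∑ k ∈ Finset.range m, (α ^ l * (α ^ u) ^ (z.1 : ℕ) * (β ^ v) ^ (z.2 : ℕ)) ^ q ^ k)
    (x y : ℕ) :
    codePolyEval c (α ^ x) (β ^ y) = ∑ k ∈ Finset.range m,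
      ((if n ∣ u * q ^ k + x then (n : K) else 0) * if n ∣ v * q ^ k + y then (n : K) else 0) *
        (α ^ l) ^ q ^ k := by
  rw [codePolyEval_eq_sum]
  simp only [hc, Finset.sum_mul]
  rw [Finset.sum_comm]
  refine Finset.sum_congr rfl fun k _ => ?_
  rw [← sum_pow_eq_ite hα, ← sum_pow_eq_ite hβ, Finset.sum_mul_sum, ← Fintype.sum_prod_type',
    Finset.sum_mul]
  refine Finset.sum_congr rfl fun z _ => ?_
  simp only [mul_pow, pow_add, ← pow_mul]
  ring

theorem traceWord_mem_zeroCode {α β : K} (hα : IsPrimitiveRoot α n) (hβ : IsPrimitiveRoot β n)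
    {l u v : ℕ} {c : Fin n × Fin n → F}
    (hc : ∀ z, algebraMap F K (c z) =
      ∑ k ∈ Finset.range m, (α ^ l * (α ^ u) ^ (z.1 : ℕ) * (β ^ v) ^ (z.2 : ℕ)) ^ q ^ k)
    {Z : Set (ℕ × ℕ)}
    (hZ : ∀ z ∈ Z, ∀ k, n ∣ u * q ^ k + z.1 → ¬ n ∣ v * q ^ k + z.2) :
    c ∈ zeroCode F n n α β Z := by
  intro z hz
  rw [codePolyEval_traceWord hα hβ hc]
  refine Finset.sum_eq_zero fun k _ => ?_
  by_cases h : n ∣ u * q ^ k + z.1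
  · rw [if_neg (hZ z hz k h), mul_zero, zero_mul]
  · rw [if_neg h, zero_mul, zero_mul]

/-- Every common zero `(x, y)` of the code, given through its negative `(u, v)`, has a `q`-multiple
congruent to one of the zeros that define the code: otherwise the trace words attached to `(u, v)`
lie in the code, and some of them do not vanish at `(x, y)`. -/
theorem exists_dvd_of_codePolyEval_eq_zero [Fintype F] {α β : K} (hα : IsPrimitiveRoot α n)
    (hβ : IsPrimitiveRoot β n) (hq : Fintype.card F = q) (hm : 1 < m) (hn : n = q ^ m - 1)
    (hnK : (n : K) ≠ 0) {Z : Set (ℕ × ℕ)} {x y u v : ℕ} (hux : n ∣ u + x) (hvy : n ∣ v + y)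
    (h : ∀ c ∈ zeroCode F n n α β Z, codePolyEval c (α ^ x) (β ^ y) = 0) :
    ∃ z ∈ Z, ∃ k, n ∣ u * q ^ k + z.1 ∧ n ∣ v * q ^ k + z.2 := by
  by_contra! hZ
  have hq2 : 2 ≤ q := hq ▸ Fintype.one_lt_card
  have h0 : ∀ l, ∑ k ∈ Finset.range m,
      ((if n ∣ u * q ^ k + x then (n : K) else 0) * if n ∣ v * q ^ k + y then (n : K) else 0) *
        (α ^ l) ^ q ^ k = 0 := by
    intro l
    obtain ⟨c, hc⟩ := exists_traceWord hα.pow_eq_one hβ.pow_eq_one hq hn l u v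
    rw [← codePolyEval_traceWord hα hβ hc]
    exact h c (traceWord_mem_zeroCode hα hβ hc hZ)
  have h1 := eq_zero_of_forall_sum_mul_pow_eq_zero hα hq2 hm hn h0 (k := 0) (by omega)
  simp [hux, hvy, hnK] at h1

/-- If no zero of the code is congruent to the negative of a `q`-multiple of a zero, then the code
contains its Euclidean dual: the trace words attached to a zero lie in the code, and orthogonality
to all of them makes the spectrum vanish at that zero. -/
theorem euclideanDual_zeroCode_le [Fintype F] {α β : K} (hα : IsPrimitiveRoot α n)
    (hβ : IsPrimitiveRoot β n) (hq : Fintype.card F = q) (hm : 1 < m) (hn : n = q ^ m - 1)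
    {Z : Set (ℕ × ℕ)}
    (hZ : ∀ w ∈ Z, ∀ z ∈ Z, ∀ k, n ∣ w.1 * q ^ k + z.1 → ¬ n ∣ w.2 * q ^ k + z.2) :
    euclideanDual (zeroCode F n n α β Z) ≤ zeroCode F n n α β Z := by
  intro r hr w hw
  have hq2 : 2 ≤ q := hq ▸ Fintype.one_lt_card
  have h0 : ∀ l, ∑ k ∈ Finset.range m,
      codePolyEval r (α ^ w.1) (β ^ w.2) ^ q ^ k * (α ^ l) ^ q ^ k = 0 := by
    intro l
    obtain ⟨c, hc⟩ := exists_traceWord hα.pow_eq_one hβ.pow_eq_one hq hn l w.1 w.2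
    have h1 := congrArg (algebraMap F K)
      (hr c (traceWord_mem_zeroCode hα hβ hc (hZ w hw)))
    rw [map_zero, map_sum] at h1
    rw [← h1]
    simp only [map_mul, hc, Finset.mul_sum]
    rw [Finset.sum_comm]
    refine Finset.sum_congr rfl fun k _ => ?_
    subst hq
    rw [← mul_pow, codePolyEval_eq_sum, Finset.sum_mul, sum_pow_card_pow]
    refine Finset.sum_congr rfl fun z _ => ?_
    have h2 : algebraMap F K (r z) ^ Fintype.card F ^ k = algebraMap F K (r z) := by
      rw [← map_pow, FiniteField.pow_card_pow]
    simp only [mul_pow]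
    rw [h2]
    ring
  have h1 := eq_zero_of_forall_sum_mul_pow_eq_zero hα hq2 hm hn h0 (k := 0) (by omega)
  simpa using h1

/-! ### Hyperbolic codes -/

theorem cast_eq_neg_one [Fintype F] (hq : Fintype.card F = q) (hm : 1 < m) (hn : n = q ^ m - 1) :
    (n : F) = -1 := by
  have h1 : 0 < q ^ m := pow_pos (hq ▸ Fintype.card_pos) _
  rw [hn, Nat.cast_sub h1, Nat.cast_pow, ← hq, FiniteField.cast_card_eq_zero,
    zero_pow (by omega)]
  simp

theorem cast_ne_zero_of_eq [Fintype F] (hq : Fintype.card F = q) (hm : 1 < m)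
    (hn : n = q ^ m - 1) : (n : K) ≠ 0 := by
  rw [← map_natCast (algebraMap F K), cast_eq_neg_one hq hm hn]
  simp

/-- The defining set of the narrow-sense hyperbolic code of length `n × n`. -/
abbrev hyperbolicSet (q n d : ℕ) : Set (ℕ × ℕ) :=
  ⋃ z ∈ designedSet n n 0 0 d, cyclotomicCoset q n n z

theorem exists_modEq_of_mem_hyperbolicSet {d : ℕ} {z : ℕ × ℕ} (hz : z ∈ hyperbolicSet q n d) :
    ∃ x y k, 1 ≤ x ∧ 1 ≤ y ∧ x * y < d ∧ z.1 ≡ x * q ^ k [MOD n] ∧ z.2 ≡ y * q ^ k [MOD n] := by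
  simp only [hyperbolicSet, designedSet, cyclotomicCoset, Set.mem_iUnion, Set.mem_ofPred_eq] at hz
  obtain ⟨w, ⟨x, y, hx, -, hy, -, hxy, rfl⟩, k, rfl⟩ := hz
  refine ⟨x, y, k, hx, hy, hxy, (Nat.mod_modEq _ _).trans ?_, (Nat.mod_modEq _ _).trans ?_⟩ <;>
  · simp only [zero_add]
    exact (Nat.mod_modEq _ _).mul_right _

theorem mem_hyperbolicSet_of_modEq {d x y k : ℕ} {z : ℕ × ℕ} (hd : d ≤ n) (hx : 1 ≤ x)
    (hy : 1 ≤ y) (hxy : x * y < d) (hz1 : z.1 < n) (hz2 : z.2 < n)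
    (h1 : z.1 ≡ x * q ^ k [MOD n]) (h2 : z.2 ≡ y * q ^ k [MOD n]) : z ∈ hyperbolicSet q n d := by
  simp only [hyperbolicSet, designedSet, cyclotomicCoset, Set.mem_iUnion, Set.mem_ofPred_eq]
  refine ⟨_, ⟨x, y, hx, by nlinarith, hy, by nlinarith, hxy, rfl⟩, k, Prod.ext ?_ ?_⟩
  · rw [← Nat.mod_eq_of_lt hz1, h1]
    simp
  · rw [← Nat.mod_eq_of_lt hz2, h2]
    simp

theorem pow_modEq_one (hn : n = q ^ m - 1) (hq : 2 ≤ q) : q ^ m ≡ 1 [MOD n] := by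
  have h1 : 0 < q ^ m := by positivity
  exact ((Nat.modEq_iff_dvd' h1).2 (by rw [hn])).symm

/-- Multiplication by `q ^ k` on residues modulo `q ^ m - 1` is inverted by multiplication by
`q ^ ((m - 1) k)`; a nonnegative exponent keeps the cosets within the natural numbers. -/
theorem pow_mul_pow_modEq_one (hn : n = q ^ m - 1) (hq : 2 ≤ q) (hm : 1 < m) (k : ℕ) :
    q ^ k * q ^ ((m - 1) * k) ≡ 1 [MOD n] := by
  have e : q ^ k * q ^ ((m - 1) * k) = (q ^ m) ^ k := by
    rw [← pow_add, ← pow_mul]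
    congr 1
    obtain ⟨r, rfl⟩ : ∃ r, m = r + 1 := ⟨m - 1, by omega⟩
    simp only [Nat.add_sub_cancel]
    ring
  rw [e]
  simpa using (pow_modEq_one hn hq).pow k

/-- The defining set is disjoint from its negative. A congruence between two of its points becomes
one between points of the designed set after multiplication by a power of `q`. -/
theorem not_dvd_of_mem_hyperbolicSet {d : ℕ} (hq : 2 ≤ q) (hm : 3 < m) (hn : n = q ^ m - 1)
    (hd : (d : ℤ) < dualContainingBound q m) {w z : ℕ × ℕ} (hw : w ∈ hyperbolicSet q n d)
    (hz : z ∈ hyperbolicSet q n d) (k : ℕ) (h1 : n ∣ w.1 * q ^ k + z.1) :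
    ¬ n ∣ w.2 * q ^ k + z.2 := by
  intro h2
  obtain ⟨x, y, i, hx, hy, hxy, hx', hy'⟩ := exists_modEq_of_mem_hyperbolicSet hw
  obtain ⟨a, b, j, ha, hb, hab, ha', hb'⟩ := exists_modEq_of_mem_hyperbolicSet hz
  have hnZ : (q : ℤ) ^ m - 1 = (n : ℤ) := by
    have h1 : 0 < q ^ m := by positivity
    rw [hn, Nat.cast_sub h1]
    simp
  have key : ∀ {s t s' t' : ℕ}, s ≡ s' * q ^ i [MOD n] → t ≡ t' * q ^ j [MOD n] →
      n ∣ s * q ^ k + t →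
      (q : ℤ) ^ m - 1 ∣ (s' : ℤ) * q ^ (i + k + (m - 1) * j) + t' := by
    intro s t s' t' hs ht hst
    rw [hnZ]
    have h3 : s' * q ^ (i + k + (m - 1) * j) + t' ≡
        (s * q ^ k + t) * q ^ ((m - 1) * j) [MOD n] := by
      have e : (s' * q ^ i * q ^ k + t' * q ^ j) * q ^ ((m - 1) * j) =
          s' * q ^ (i + k + (m - 1) * j) + t' * (q ^ j * q ^ ((m - 1) * j)) := by
        simp only [pow_add]; ring
      have h4 := (((hs.mul_right (q ^ k)).add ht).mul_right (q ^ ((m - 1) * j)))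
      rw [e] at h4
      have h5 := ((pow_mul_pow_modEq_one hn hq (by omega) j).mul_left t').add_left
        (s' * q ^ (i + k + (m - 1) * j))
      rw [mul_one] at h5
      exact (h4.trans h5).symm
    have h6 : n ∣ s' * q ^ (i + k + (m - 1) * j) + t' :=
      (h3.dvd_iff dvd_rfl).2 (hst.mul_right _)
    exact_mod_cast h6
  exact false_of_dvd_of_mul_lt hq hm hd.le (x := x) (y := y) (x' := a) (y' := b)
    (by exact_mod_cast hx) (by exact_mod_cast hy) (by exact_mod_cast ha) (by exact_mod_cast hb)
    (by exact_mod_cast hxy) (by exact_mod_cast hab) _ (key hx' ha' h1) (key hy' hb' h2)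

theorem lt_of_lt_dualContainingBound {d : ℕ} (hq : 2 ≤ q) (hm : 3 < m) (hn : n = q ^ m - 1)
    (hd : (d : ℤ) < dualContainingBound q m) : d < n := by
  have h1 := dualContainingBound_le hq hm
  have h2 : 0 < q ^ m := by positivity
  have h3 : (q : ℤ) ^ m = ((q ^ m : ℕ) : ℤ) := by simp
  omega

theorem isNarrowSenseHyperbolicCode_zeroCode [Fintype F] {d : ℕ} {α β : K}
    (hα : IsPrimitiveRoot α n) (hβ : IsPrimitiveRoot β n) (hq : Fintype.card F = q) (hm : 1 < m)
    (hn : n = q ^ m - 1) (hd : d ≤ n) :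
    IsNarrowSenseHyperbolicCode α β d (zeroCode F n n α β (hyperbolicSet q n d)) where
  bicyclic := by
    refine isBicyclicCode_zeroCode hα.pow_eq_one hβ.pow_eq_one ?_ _
    have h1 : 0 < q ^ m := pow_pos (hq ▸ Fintype.card_pos) _
    have h2 : Nat.Coprime n q := by
      have h3 : Nat.Coprime n (n + 1) := by simp
      rw [hn, Nat.sub_add_cancel h1, ← hn] at h3
      exact Nat.Coprime.coprime_dvd_right (dvd_pow_self q (by omega)) h3
    rw [Nat.card_eq_fintype_card, hq]
    exact Nat.Coprime.mul_left h2 h2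
  definingSet_eq := by
    have hq2 : 2 ≤ q := hq ▸ Fintype.one_lt_card
    rw [Nat.card_eq_fintype_card, hq]
    ext w
    constructor
    · rintro ⟨hw1, hw2, hw⟩
      obtain ⟨z, hz, k, h1, h2⟩ := exists_dvd_of_codePolyEval_eq_zero hα hβ hq hm hn
        (cast_ne_zero_of_eq hq hm hn) (u := n - w.1) (v := n - w.2)
        (by rw [Nat.sub_add_cancel hw1.le]) (by rw [Nat.sub_add_cancel hw2.le]) hw
      obtain ⟨x, y, j, hx, hy, hxy, hzx, hzy⟩ := exists_modEq_of_mem_hyperbolicSet hz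
      have key : ∀ {s t r : ℕ}, s < n → n ∣ (n - s) * q ^ k + t → t ≡ r * q ^ j [MOD n] →
          s ≡ r * q ^ (j + (m - 1) * k) [MOD n] := by
        intro s t r hs hd ht
        have h3 : s * q ^ k ≡ t [MOD n] := by
          have h4 : s * q ^ k + (n - s) * q ^ k = n * q ^ k := by
            rw [← add_mul, Nat.add_sub_cancel' hs.le]
          have h5 : s * q ^ k + (n - s) * q ^ k ≡ t + (n - s) * q ^ k [MOD n] := by
            rw [h4, add_comm t]
            exact ((Nat.modEq_zero_iff_dvd.2 (dvd_mul_right _ _))).trans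
              (Nat.modEq_zero_iff_dvd.2 hd).symm
          exact Nat.ModEq.add_right_cancel' _ h5
        have h6 := (h3.trans ht).mul_right (q ^ ((m - 1) * k))
        have h7 := (pow_mul_pow_modEq_one hn hq2 hm k).mul_left s
        rw [mul_one, ← mul_assoc] at h7
        rw [pow_add, ← mul_assoc]
        exact h7.symm.trans h6
      exact mem_hyperbolicSet_of_modEq hd hx hy hxy hw1 hw2 (key hw1 h1 hzx) (key hw2 h2 hzy)
    · intro hw
      refine ⟨?_, ?_, fun c hc => hc w hw⟩
      all_goals
        simp only [designedSet, cyclotomicCoset, Set.mem_iUnion, Set.mem_ofPred_eq] at hw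
        obtain ⟨w, ⟨x, y, hx, hxn, -, -, -, rfl⟩, k, rfl⟩ := hw
        exact Nat.mod_lt _ (by omega)

theorem le_card_support_of_mem_zeroCode {d : ℕ} {α β : K} (hα : IsPrimitiveRoot α n)
    (hβ : IsPrimitiveRoot β n) (hd : d < n) {c : Fin n × Fin n → F}
    (hc : c ∈ zeroCode F n n α β (hyperbolicSet q n d)) (h0 : c ≠ 0) :
    d ≤ {z | c z ≠ 0}.ncard := by
  refine le_card_support_of_forall_mul_lt hα hβ h0 fun x y hx hy hxy => ?_
  exact hc (x, y) (mem_hyperbolicSet_of_modEq (k := 0) hd.le hx hy hxy (by nlinarith) (by nlinarith)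
    (by simp [Nat.ModEq.refl]) (by simp [Nat.ModEq.refl]))

/-- The all-one array lies in the hyperbolic code: its only nonzero spectral coefficient is that at
the origin. -/
theorem one_mem_zeroCode {d : ℕ} {α β : K} (hα : IsPrimitiveRoot α n) (hq : 2 ≤ q)
    (hm : 1 < m) (hn : n = q ^ m - 1) (hd : d < n) :
    (1 : Fin n × Fin n → F) ∈ zeroCode F n n α β (hyperbolicSet q n d) := by
  intro z hz
  obtain ⟨x, y, k, hx, hy, hxy, hzx, -⟩ := exists_modEq_of_mem_hyperbolicSet hz
  have h1 : ¬ n ∣ z.1 := by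
    intro h
    have h2 := (Nat.modEq_zero_iff_dvd.1
      (hzx.symm.trans (Nat.modEq_zero_iff_dvd.2 h))).mul_right (q ^ ((m - 1) * k))
    have h3 := (pow_mul_pow_modEq_one hn hq hm k).mul_left x
    rw [mul_one, ← mul_assoc] at h3
    have h4 := Nat.le_of_dvd (by omega) ((h3.dvd_iff dvd_rfl).1 h2)
    nlinarith
  simp only [codePolyEval, Pi.one_apply, map_one, one_mul]
  rw [← Finset.sum_mul_sum, sum_pow_eq_ite hα, if_neg h1, zero_mul]

theorem one_notMem_euclideanDual_zeroCode [Fintype F] {d : ℕ} {α β : K} (hα : IsPrimitiveRoot α n)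
    (hq : Fintype.card F = q) (hm : 1 < m) (hn : n = q ^ m - 1)
    (hd : d < n) :
    (1 : Fin n × Fin n → F) ∉ euclideanDual (zeroCode F n n α β (hyperbolicSet q n d)) := by
  intro h
  have hq2 : 2 ≤ q := hq ▸ Fintype.one_lt_card
  have h1 := h 1 (one_mem_zeroCode hα hq2 hm hn hd)
  simp [cast_eq_neg_one hq hm hn] at h1

end Trace

/-! ### Duality and characters -/

theorem euclideanDual_euclideanDual {F ι : Type*} [Field F] [Fintype ι]
    (C : Submodule F (ι → F)) : euclideanDual (euclideanDual C) = C := by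
  classical
  let B : LinearMap.BilinForm F (ι → F) := dotProductBilin F F
  have hB : ∀ u v, B u v = ∑ i, u i * v i := fun u v => rfl
  have hrefl : B.IsRefl := by
    intro u v h
    rw [hB] at h ⊢
    simpa only [mul_comm] using h
  have hnd : B.Nondegenerate := by
    refine (LinearMap.IsRefl.nondegenerate_iff_separatingLeft hrefl).2 fun u h => ?_
    funext i
    simpa [hB, Pi.single_apply] using h (Pi.single i 1)
  have hdual : ∀ W : Submodule F (ι → F), euclideanDual W = B.orthogonal W := by
    intro W
    ext u
    rw [LinearMap.BilinForm.mem_orthogonal_iff]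
    refine forall₂_congr fun v _ => ?_
    rw [hB]
    simp only [mul_comm]
  rw [hdual, hdual, LinearMap.BilinForm.orthogonal_orthogonal hnd hrefl]

section Character

variable (p : ℕ) [Fact p.Prime] {F : Type*} [Field F] [Finite F] [Algebra (ZMod p) F]

/-- The additive character `x ↦ exp (2 π i tr x / p)` of a finite field detects zero among the
multiples of an element. -/
theorem exists_stdAddChar_trace_mul_ne_one {a : F} (ha : a ≠ 0) :
    ∃ r : F, ZMod.stdAddChar (Algebra.trace (ZMod p) F (r * a)) ≠ (1 : ℂ) := by
  obtain ⟨y, hy⟩ : ∃ y : F, Algebra.trace (ZMod p) F y ≠ 0 := by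
    by_contra! h
    exact Algebra.trace_ne_zero (ZMod p) F (LinearMap.ext h)
  refine ⟨y * a⁻¹, fun h => hy ?_⟩
  rw [inv_mul_cancel_right₀ ha, ← AddChar.map_zero_eq_one (ZMod.stdAddChar (N := p))] at h
  exact ZMod.injective_stdAddChar h

end Character

/-! ### The quantum code of a dual-containing code -/

section CosetState

variable {F ι : Type*} [Field F]

/-- The indicator function of a coset of the dual code, as an unnormalized state. -/
noncomputable def cosetState (D : Submodule F (ι → F)) (c : ι → F) : QuditSpace F ι :=
  WithLp.toLp 2 (Set.indicator {x | x - c ∈ D} 1)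

theorem cosetState_apply_of_mem {D : Submodule F (ι → F)} {c x : ι → F} (h : x - c ∈ D) :
    cosetState D c x = 1 :=
  Set.indicator_of_mem (s := {x | x - c ∈ D}) h 1

theorem cosetState_apply_of_notMem {D : Submodule F (ι → F)} {c x : ι → F} (h : x - c ∉ D) :
    cosetState D c x = 0 :=
  Set.indicator_of_notMem (s := {x | x - c ∈ D}) h 1

theorem cosetState_self_ne_zero (D : Submodule F (ι → F)) (c : ι → F) : cosetState D c ≠ 0 := by
  intro h
  have h1 := cosetState_apply_of_mem (D := D) (c := c) (x := c) (by simp)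
  rw [h] at h1
  simp at h1

end CosetState

section Quantum

variable (p : ℕ) [Fact p.Prime] {F ι : Type*} [Field F] [Algebra (ZMod p) F] [Fintype ι]

theorem errorOp_apply (a b : ι → F) (ψ : QuditSpace F ι) (x : ι → F) :
    errorOp p a b ψ x =
      ZMod.stdAddChar (Algebra.trace (ZMod p) F (∑ i, b i * (x - a) i)) * ψ (x - a) :=
  rfl

theorem errorOp_zero_left_apply (b : ι → F) (ψ : QuditSpace F ι) (x : ι → F) :
    errorOp p 0 b ψ x =
      ZMod.stdAddChar (Algebra.trace (ZMod p) F (∑ i, b i * x i)) * ψ x := by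
  simp [errorOp_apply]

theorem errorOp_zero_right_apply (a : ι → F) (ψ : QuditSpace F ι) (x : ι → F) :
    errorOp p a 0 ψ x = ψ (x - a) := by
  simp [errorOp_apply]

theorem errorOp_zero_zero : errorOp p (0 : ι → F) (0 : ι → F) = LinearMap.id := by
  ext ψ x
  simp [errorOp_apply]

/-- Error operators multiply without a phase when `b` is orthogonal to `a'`. -/
theorem errorOp_comp {a b a' b' : ι → F} (h : ∑ i, b i * a' i = 0) :
    errorOp p a b ∘ₗ errorOp p a' b' = errorOp p (a + a') (b + b') := by
  ext ψ x
  rw [LinearMap.comp_apply, errorOp_apply, errorOp_apply, errorOp_apply, ← mul_assoc,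
    ← AddChar.map_add_eq_mul, ← map_add, sub_sub, ← Finset.sum_add_distrib]
  congr 3
  have h1 : ∀ i, b i * (x - a) i + b' i * (x - (a + a')) i =
      (b + b') i * (x - (a + a')) i + b i * a' i := by
    intro i
    simp only [Pi.sub_apply, Pi.add_apply]
    ring
  rw [Finset.sum_congr rfl fun i _ => h1 i, Finset.sum_add_distrib, h, add_zero]

theorem mem_cssCode {C : Submodule F (ι → F)} {ψ : QuditSpace F ι} :
    ψ ∈ cssCode p C ↔
      ∀ a ∈ euclideanDual C, ∀ b ∈ euclideanDual C, errorOp p a b ψ = ψ := by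
  simp [cssCode, Submodule.mem_iInf]

theorem exists_mem_stdAddChar_ne_one [Finite F] {D : Submodule F (ι → F)} {x : ι → F}
    (hx : x ∉ euclideanDual D) :
    ∃ b ∈ D, ZMod.stdAddChar (Algebra.trace (ZMod p) F (∑ i, x i * b i)) ≠ (1 : ℂ) := by
  have h : ∃ b ∈ D, ∑ i, x i * b i ≠ 0 := by
    by_contra! h
    exact hx h
  obtain ⟨b, hb, hne⟩ := h
  obtain ⟨r, hr⟩ := exists_stdAddChar_trace_mul_ne_one p hne
  refine ⟨r • b, D.smul_mem r hb, ?_⟩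
  rwa [Finset.mul_sum, Finset.sum_congr rfl fun i _ => mul_left_comm r (x i) (b i)] at hr

/-- The quantum code consists of the states that are supported on `C` and invariant under
translation by the dual code. -/
theorem mem_cssCode_iff [Finite F] {C : Submodule F (ι → F)} {ψ : QuditSpace F ι} :
    ψ ∈ cssCode p C ↔
      (∀ x, x ∉ C → ψ x = 0) ∧ ∀ a ∈ euclideanDual C, ∀ x, ψ (x - a) = ψ x := by
  rw [mem_cssCode]
  constructor
  · refine fun h => ⟨fun x hx => ?_, fun a ha x => ?_⟩
    · rw [← euclideanDual_euclideanDual C] at hx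
      obtain ⟨b, hb, hne⟩ := exists_mem_stdAddChar_ne_one p hx
      have h1 := congrArg (fun φ : QuditSpace F ι => φ x) (h 0 (zero_mem _) b hb)
      simp only [errorOp_zero_left_apply] at h1
      by_contra h0
      refine hne (mul_right_cancel₀ h0 ?_)
      simpa only [one_mul, mul_comm (b _)] using h1
    · have h1 := congrArg (fun φ : QuditSpace F ι => φ x) (h a ha 0 (zero_mem _))
      simpa only [errorOp_zero_right_apply] using h1
  · rintro ⟨h1, h2⟩ a ha b hb
    ext x
    rw [errorOp_apply, h2 a ha x]
    by_cases hx : x - a ∈ C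
    · rw [hb _ hx, map_zero, AddChar.map_zero_eq_one, one_mul]
    · rw [← h2 a ha, h1 _ hx, mul_zero]

theorem cosetState_mem_cssCode [Finite F] {C : Submodule F (ι → F)} (hC : euclideanDual C ≤ C)
    {c : ι → F} (hc : c ∈ C) : cosetState (euclideanDual C) c ∈ cssCode p C := by
  rw [mem_cssCode_iff]
  refine ⟨fun x hx => cosetState_apply_of_notMem fun h => hx ?_, fun a ha x => ?_⟩
  · simpa using C.add_mem (hC h) hc
  · have h1 : x - a - c ∈ euclideanDual C ↔ x - c ∈ euclideanDual C := by
      rw [sub_right_comm]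
      exact Submodule.sub_mem_iff_left _ ha
    by_cases h : x - c ∈ euclideanDual C
    · rw [cosetState_apply_of_mem h, cosetState_apply_of_mem (h1.2 h)]
    · rw [cosetState_apply_of_notMem h, cosetState_apply_of_notMem (mt h1.1 h)]

/-- The operators `X(a) Z(b)` with `a`, `b` in the dual code form a group without phases, because
the dual code is self-orthogonal. -/
theorem isStabilizerCode_cssCode [Finite F] {C : Submodule F (ι → F)} (hC : euclideanDual C ≤ C) :
    IsStabilizerCode p (cssCode p C) := by
  have horth : ∀ {a b : ι → F}, a ∈ euclideanDual C → b ∈ euclideanDual C →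
      ∑ i, b i * a i = 0 := fun ha hb => hb _ (hC ha)
  have hinv : ∀ {a b : ι → F}, a ∈ euclideanDual C → b ∈ euclideanDual C →
      errorOp p a b ∘ₗ errorOp p (-a) (-b) = LinearMap.id := by
    intro a b ha hb
    rw [errorOp_comp p (horth (neg_mem ha) hb), add_neg_cancel, add_neg_cancel,
      errorOp_zero_zero]
  refine ⟨fun h => cosetState_self_ne_zero (euclideanDual C) 0
    ((Submodule.eq_bot_iff _).1 h _ (cosetState_mem_cssCode p hC (zero_mem C))), ?_⟩
  refine ⟨{ carrier := {E | ∃ a ∈ euclideanDual C, ∃ b ∈ euclideanDual C,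
              (E : QuditSpace F ι →ₗ[ℂ] QuditSpace F ι) = errorOp p a b}
            one_mem' := ⟨0, zero_mem _, 0, zero_mem _, (errorOp_zero_zero p).symm⟩
            mul_mem' := ?_
            inv_mem' := ?_ }, ?_, fun ψ => ?_⟩
  · rintro E E' ⟨a, ha, b, hb, hE⟩ ⟨a', ha', b', hb', hE'⟩
    refine ⟨a + a', add_mem ha ha', b + b', add_mem hb hb', ?_⟩
    rw [← errorOp_comp p (horth ha' hb), ← hE, ← hE']
    rfl
  · rintro E ⟨a, ha, b, hb, hE⟩
    refine ⟨-a, neg_mem ha, -b, neg_mem hb, ?_⟩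
    ext1 ψ
    apply E.injective
    have h1 := LinearMap.congr_fun (hinv ha hb) ψ
    rw [← hE] at h1
    exact (E.apply_symm_apply ψ).trans h1.symm
  · rintro E ⟨a, -, b, -, hE⟩
    exact ⟨0, a, b, by rw [hE, AddChar.map_zero_eq_one, one_smul]⟩
  · rw [mem_cssCode]
    constructor
    · rintro h E ⟨a, ha, b, hb, hE⟩
      exact (LinearMap.congr_fun hE ψ).trans (h a ha b hb)
    · intro h a ha b hb
      have hinv' := hinv (neg_mem ha) (neg_mem hb)
      rw [neg_neg, neg_neg] at hinv'
      exact h (LinearEquiv.ofLinearMap _ _ (hinv ha hb) hinv') ⟨a, ha, b, hb, rfl⟩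

/-- Distinct cosets of the dual code in `C` give linearly independent states. -/
theorem one_lt_finrank_cssCode [Finite F] {C : Submodule F (ι → F)} (hC : euclideanDual C ≤ C)
    {c : ι → F} (hc : c ∈ C) (hc' : c ∉ euclideanDual C) : 1 < Module.finrank ℂ (cssCode p C) := by
  let φ : cssCode p C := ⟨_, cosetState_mem_cssCode p hC (zero_mem C)⟩
  let ψ : cssCode p C := ⟨_, cosetState_mem_cssCode p hC hc⟩
  have hli : LinearIndependent ℂ ![φ, ψ] := by
    rw [LinearIndependent.pair_iff]
    intro s t h
    have h1 : ∀ x, s * cosetState (euclideanDual C) 0 x +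
        t * cosetState (euclideanDual C) c x = 0 := fun x =>
      congrArg (fun χ : cssCode p C => (χ : QuditSpace F ι) x) h
    have h2 := h1 0
    have h3 := h1 c
    rw [cosetState_apply_of_mem (by simp), cosetState_apply_of_notMem (by simpa using hc')] at h2
    rw [cosetState_apply_of_notMem (by simpa using hc'), cosetState_apply_of_mem (by simp)] at h3
    simp at h2 h3
    exact ⟨h2, h3⟩
  exact Nat.lt_of_succ_le (by simpa using hli.fintype_card_le_finrank)

/-- The quantum code inherits the minimum distance of `C`. An error of smaller weight is trivial,
moves the support off `C`, or acts on the states by a character that is nontrivial on the dual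
code; in the last two cases its matrix elements vanish. -/
theorem hasDistanceAtLeast_cssCode [Fintype F] [DecidableEq ι] {C : Submodule F (ι → F)}
    {d : ℕ} (hd : ∀ c ∈ C, c ≠ 0 → d ≤ {i | c i ≠ 0}.ncard) :
    HasDistanceAtLeast p (cssCode p C) d := by
  intro a b hw
  have hzero : ∀ {e : ι → F}, (∀ i, e i ≠ 0 → a i ≠ 0 ∨ b i ≠ 0) → e ∈ C → e = 0 := by
    intro e he heC
    by_contra h0
    exact absurd ((hd e heC h0).trans (Set.ncard_le_ncard he (Set.toFinite _))) (not_le.2 hw)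
  by_cases ha : a ∈ C
  · have ha0 : a = 0 := hzero (fun i => Or.inl) ha
    subst ha0
    by_cases hb : b ∈ C
    · have hb0 : b = 0 := hzero (fun i => Or.inr) hb
      subst hb0
      exact ⟨1, fun φ _ ψ _ => by rw [errorOp_zero_zero, LinearMap.id_apply, one_mul]⟩
    · -- Translating the sum by an element of the dual code on which the character of `b` is
      -- nontrivial multiplies the inner product by a number other than `1`.
      refine ⟨0, fun φ hφ ψ hψ => ?_⟩
      rw [← euclideanDual_euclideanDual C] at hb
      obtain ⟨u, hu, hne⟩ := exists_mem_stdAddChar_ne_one p hb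
      rw [mem_cssCode_iff] at hφ hψ
      have h1 : inner ℂ φ (errorOp p 0 b ψ) =
          ZMod.stdAddChar (Algebra.trace (ZMod p) F (∑ i, b i * u i)) *
            inner ℂ φ (errorOp p 0 b ψ) := by
        simp only [PiLp.inner_apply, errorOp_zero_left_apply]
        conv_lhs => rw [← Equiv.sum_comp (Equiv.addRight u)]
        rw [Finset.mul_sum]
        refine Finset.sum_congr rfl fun x _ => ?_
        have h2 := hφ.2 u hu (x + u)
        have h3 := hψ.2 u hu (x + u)
        rw [add_sub_cancel_right] at h2 h3
        simp only [Equiv.coe_addRight, ← h2, ← h3, Pi.add_apply, mul_add, Finset.sum_add_distrib,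
          map_add, AddChar.map_add_eq_mul, RCLike.inner_apply]
        ring
      rw [zero_mul]
      by_contra h0
      exact hne (mul_right_cancel₀ h0 (by rw [one_mul]; exact h1.symm))
  · refine ⟨0, fun φ hφ ψ hψ => ?_⟩
    rw [mem_cssCode_iff] at hφ hψ
    rw [zero_mul, PiLp.inner_apply]
    refine Finset.sum_eq_zero fun x _ => ?_
    rw [errorOp_apply]
    by_cases hx : x ∈ C
    · have hxa : x - a ∉ C := fun h => ha (by simpa using C.sub_mem hx h)
      rw [hψ.1 _ hxa, mul_zero, inner_zero_right]
    · rw [hφ.1 x hx, inner_zero_left]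

end Quantum

/-! ### Quantum hyperbolic codes -/

theorem mainTheorem5 (p : ℕ) [Fact p.Prime] (F : Type*) [Field F] [Fintype F] [Algebra (ZMod p) F]
    (q m n d : ℕ) (hq : Fintype.card F = q) (hm : 3 < m) (hn : n = q ^ m - 1)
    (hd : (d : ℤ) < dualContainingBound q m) :
    (∃ α : AlgebraicClosure F, IsPrimitiveRoot α n) ∧
    ∀ α β : AlgebraicClosure F, IsPrimitiveRoot α n → IsPrimitiveRoot β n →
      ∃ C : Submodule F (Fin n × Fin n → F),
        IsNarrowSenseHyperbolicCode α β d C ∧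
        euclideanDual C ≤ C ∧
        IsStabilizerCode p (cssCode p C) ∧
        1 < Module.finrank ℂ (cssCode p C) ∧
        HasDistanceAtLeast p (cssCode p C) d := by
  have hq2 : 2 ≤ q := hq ▸ Fintype.one_lt_card
  have hm1 : 1 < m := by omega
  have hdn : d < n := lt_of_lt_dualContainingBound hq2 hm hn hd
  refine ⟨?_, fun α β hα hβ => ?_⟩
  · have : NeZero (n : AlgebraicClosure F) := ⟨cast_ne_zero_of_eq hq hm1 hn⟩
    exact HasEnoughRootsOfUnity.exists_primitiveRoot _ n
  · have hC := euclideanDual_zeroCode_le hα hβ hq hm1 hn (Z := hyperbolicSet q n d)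
      fun w hw z hz => not_dvd_of_mem_hyperbolicSet hq2 hm hn hd hw hz
    exact ⟨zeroCode F n n α β (hyperbolicSet q n d),
      isNarrowSenseHyperbolicCode_zeroCode hα hβ hq hm1 hn hdn.le, hC,
      isStabilizerCode_cssCode p hC,
      one_lt_finrank_cssCode p hC (one_mem_zeroCode hα hq2 hm1 hn hdn)
        (one_notMem_euclideanDual_zeroCode hα hq hm1 hn hdn),
      hasDistanceAtLeast_cssCode p fun c hc h0 => le_card_support_of_mem_zeroCode hα hβ hdn hc h0⟩
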